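/- Let $\mathcal W=W(2,2)$ be the complex Lie algebra with basis $\{L_n,W_n,z\mid n\in\mathbb Z\}$ and brackets $$[L_n,L_m]=(m-n)L_{m+n}+\tfrac{n^3-n}{12}\delta_{m+n,0}z,\qquad [L_n,W_m]=(m-n)W_{m+n}+\tfrac{n^3-n}{12}\delta_{m+n,0}z,$$ $$[W_n,W_m]=[z,W_m]=[z,L_m]=0,$$ let $\mathcal U(\mathcal W)$ be its universal enveloping algebra, $S(z)=\mathbb C[z]$ the algebra of polynomials in the central element $z$, and $\mathcal W_+$ the subalgebra spanned by the $L_n,W_n$ with $n>0$. Let $\varphi:\mathcal W_+\to\mathbb C$ be a Lie algebra homomorphism which is non-singular, i.e. $\varphi(L_i)\varphi(W_i)\neq 0$ for $i=1,2$. A vector $v$ of a $\mathcal W$-module $V$ is a Whittaker vector (of type $\varphi$) if $xv=\varphi(x)v$ for all $x\in\mathcal W_+$; if moreover $v$ generates $V$, then $V$ is called a Whittaker module of type $\varphi$ with cyclic Whittaker vector $v$. Suppose that $V$ is a Whittaker module of type $\varphi$ with cyclic Whittaker vector $w$, and that $\mathrm{Ann}_{S(z)}(w)=\{q(z)\in S(z)\mid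 q(z)w=0\}\neq 0$. Let $p(z)$ be the unique monic generator of the ideal $\mathrm{Ann}_{S(z)}(w)$, and write $p(z)=\prod_{i=1}^k(z-\xi_i)^{a_i}$ with pairwise distinct $\xi_i\in\mathbb C$ and integers $a_i\geq 1$. For $1\le j\le k$ put $w_j=\prod_{i\neq j}(z-\xi_i)^{a_i}\,w$ and $V_j=\mathcal U(\mathcal W)w_j$. Then: 1. each $V_j$ is a Whittaker module of type $\varphi$ with cyclic Whittaker vector $w_j$; 2. $V=V_1\oplus\cdots\oplus V_k$; 3. each $V_j$ is indecomposable, that is, it is nonzero and is not the direct sum of two nonzero submodules; 4. each $V_j$ has composition length $a_j$. -/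

import Mathlib

open Polynomial

/-- Labels of the basis `{L n, W n, z | n ∈ ℤ}` of the Lie algebra `W(2,2)`. -/
inductive W22Index : Type
  | L (n : ℤ)
  | W (n : ℤ)
  | z
  deriving DecidableEq

/-- The underlying complex vector space of `W(2,2)`: finitely supported complex combinations of
the basis labels. -/
def W22 : Type := W22Index →₀ ℂ

namespace W22

noncomputable instance : AddCommGroup W22 := inferInstanceAs (AddCommGroup (W22Index →₀ ℂ))

noncomputable instance : Module ℂ W22 := inferInstanceAs (Module ℂ (W22Index →₀ ℂ))

/-- The standard basis of `W(2,2)`. -/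
noncomputable def basis : Module.Basis W22Index ℂ W22 := ⟨LinearEquiv.refl ℂ (W22Index →₀ ℂ)⟩

/-- The basis vector `L n`. -/
noncomputable def L (n : ℤ) : W22 := basis (W22Index.L n)

/-- The basis vector `W n`. -/
noncomputable def W (n : ℤ) : W22 := basis (W22Index.W n)

/-- The central basis vector `z`. -/
noncomputable def z : W22 := basis W22Index.z

/-- The central term `δ_{m+n,0} (n^3 - n)/12`. -/
noncomputable def cocycle (n m : ℤ) : ℂ := if m + n = 0 then ((n : ℂ) ^ 3 - n) / 12 else 0

/-- The bracket on pairs of basis vectors. -/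
noncomputable def basisBracket : W22Index → W22Index → W22
  | .L n, .L m => ((m : ℂ) - n) • L (m + n) + cocycle n m • z
  | .L n, .W m => ((m : ℂ) - n) • W (m + n) + cocycle n m • z
  | .W n, .L m => -(((n : ℂ) - m) • W (n + m) + cocycle m n • z)
  | .W _, .W _ => 0
  | .z, _ => 0
  | _, .z => 0

/-- The bracket as a bilinear map. -/
noncomputable def bracketBilin : W22 →ₗ[ℂ] W22 →ₗ[ℂ] W22 :=
  basis.constr ℂ fun i => basis.constr ℂ fun j => basisBracket i j

theorem bracketBilin_basis (i j : W22Index) :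
    bracketBilin (basis i) (basis j) = basisBracket i j := by
  simp [bracketBilin]

noncomputable instance : Bracket W22 W22 := ⟨fun x y => bracketBilin x y⟩

theorem bracket_def (x y : W22) : ⁅x, y⁆ = bracketBilin x y := rfl

theorem lie_L_L (n m : ℤ) : ⁅L n, L m⁆ = ((m : ℂ) - n) • L (m + n) + cocycle n m • z :=
  bracketBilin_basis _ _

theorem lie_L_W (n m : ℤ) : ⁅L n, W m⁆ = ((m : ℂ) - n) • W (m + n) + cocycle n m • z :=
  bracketBilin_basis _ _

theorem lie_W_L (n m : ℤ) : ⁅W n, L m⁆ = -(((n : ℂ) - m) • W (n + m) + cocycle m n • z) :=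
  bracketBilin_basis _ _

theorem lie_W_W (n m : ℤ) : ⁅W n, W m⁆ = 0 := bracketBilin_basis _ _

theorem bracketBilin_z_left (x : W22) : bracketBilin z x = 0 := by
  have h : bracketBilin z = 0 := basis.ext fun j => by
    rw [z, bracketBilin_basis]; simp [basisBracket]
  rw [h]; rfl

theorem cocycle_antisymm (n m : ℤ) : cocycle n m = -cocycle m n := by
  unfold cocycle
  by_cases h : m + n = 0
  · have h' : n + m = 0 := by omega
    have hm : m = -n := by omega
    rw [if_pos h, if_pos h', hm]; push_cast; ring
  · have h' : ¬ n + m = 0 := by omega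
    rw [if_neg h, if_neg h']; simp

theorem basisBracket_antisymm (i j : W22Index) : basisBracket i j = -basisBracket j i := by
  cases i <;> cases j <;> simp only [basisBracket, neg_neg, neg_zero]
  rename_i n m
  rw [cocycle_antisymm n m, add_comm m n]
  module

theorem bracketBilin_antisymm (x y : W22) : bracketBilin x y = -bracketBilin y x := by
  have h : bracketBilin = -bracketBilin.flip := basis.ext fun i => basis.ext fun j => by
    simp only [LinearMap.neg_apply, LinearMap.flip_apply, bracketBilin_basis]
    exact basisBracket_antisymm i j
  exact congrArg (fun f => f x y) h

theorem bracketBilin_z_right (x : W22) : bracketBilin x z = 0 := by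
  rw [bracketBilin_antisymm, bracketBilin_z_left, neg_zero]

theorem bracketBilin_self (x : W22) : bracketBilin x x = 0 := by
  have h : (2 : ℂ) • bracketBilin x x = 0 := by
    rw [two_smul, ← eq_neg_iff_add_eq_zero]
    exact bracketBilin_antisymm x x
  exact (smul_eq_zero.mp h).resolve_left two_ne_zero

theorem bracketBilin_jacobi_basis (i j k : W22Index) :
    bracketBilin (basis i) (bracketBilin (basis j) (basis k)) =
      bracketBilin (bracketBilin (basis i) (basis j)) (basis k) +
        bracketBilin (basis j) (bracketBilin (basis i) (basis k)) := by
  have hz : ∀ x : W22, bracketBilin (basis .z) x = 0 := bracketBilin_z_left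
  have hz' : ∀ x : W22, bracketBilin x (basis .z) = 0 := bracketBilin_z_right
  cases i <;> cases j <;> cases k <;>
    simp only [bracketBilin_basis, basisBracket, L, W, z, map_add, map_smul, map_neg, map_zero, hz,
      hz', LinearMap.add_apply, LinearMap.smul_apply, LinearMap.neg_apply, LinearMap.zero_apply,
      smul_zero, add_zero, neg_zero]
  all_goals
    rename_i l m n
    by_cases h : l + m + n = 0
    · obtain rfl : n = -l - m := by omega
      simp only [cocycle]
      ring_nf
      simp
      try module
    · simp only [cocycle]
      rw [if_neg (by omega), if_neg (by omega), if_neg (by omega)]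
      ring_nf
      module

theorem bracketBilin_jacobi (x y t : W22) :
    bracketBilin x (bracketBilin y t) =
      bracketBilin (bracketBilin x y) t + bracketBilin y (bracketBilin x t) := by
  induction basis.mem_span x using Submodule.span_induction with
  | zero => simp
  | add x x' _ _ hx hx' => simp only [map_add, LinearMap.add_apply, hx, hx']; abel
  | smul c x _ hx => simp only [map_smul, LinearMap.smul_apply, hx, smul_add]
  | mem x hx =>
    obtain ⟨i, rfl⟩ := hx
    induction basis.mem_span y using Submodule.span_induction with
    | zero => simp
    | add y y' _ _ hy hy' => simp only [map_add, LinearMap.add_apply, hy, hy']; abel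
    | smul c y _ hy => simp only [map_smul, LinearMap.smul_apply, hy, smul_add]
    | mem y hy =>
      obtain ⟨j, rfl⟩ := hy
      induction basis.mem_span t using Submodule.span_induction with
      | zero => simp
      | add t t' _ _ ht ht' => simp only [map_add, ht, ht']; abel
      | smul c t _ ht => simp only [map_smul, ht, smul_add]
      | mem t ht =>
        obtain ⟨k, rfl⟩ := ht
        exact bracketBilin_jacobi_basis i j k

noncomputable instance : LieRing W22 where
  add_lie x y t := by simp [bracket_def]
  lie_add x y t := by simp [bracket_def]
  lie_self := bracketBilin_self
  leibniz_lie := bracketBilin_jacobi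

noncomputable instance : LieAlgebra ℂ W22 where
  lie_smul c x y := by simp [bracket_def]

theorem lie_z_left (x : W22) : ⁅z, x⁆ = 0 := bracketBilin_z_left x

/-- The generators `L n`, `W n` with `n > 0` of the positive part, as a vector space. -/
def posGenerators : Set W22 := {x | ∃ n : ℤ, 0 < n ∧ (x = L n ∨ x = W n)}

theorem lie_mem_span_posGenerators {x y : W22} (hx : x ∈ posGenerators)
    (hy : y ∈ posGenerators) : ⁅x, y⁆ ∈ Submodule.span ℂ posGenerators := by
  have hc : ∀ n m : ℤ, 0 < n → 0 < m → cocycle n m = 0 := fun n m hn hm => if_neg (by omega)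
  have hL : ∀ n m : ℤ, 0 < n → 0 < m → L (m + n) ∈ Submodule.span ℂ posGenerators :=
    fun n m hn hm => Submodule.subset_span ⟨m + n, by omega, Or.inl rfl⟩
  have hW : ∀ n m : ℤ, 0 < n → 0 < m → W (m + n) ∈ Submodule.span ℂ posGenerators :=
    fun n m hn hm => Submodule.subset_span ⟨m + n, by omega, Or.inr rfl⟩
  obtain ⟨n, hn, rfl | rfl⟩ := hx <;> obtain ⟨m, hm, rfl | rfl⟩ := hy
  · rw [lie_L_L, hc n m hn hm, zero_smul, add_zero]
    exact Submodule.smul_mem _ _ (hL n m hn hm)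
  · rw [lie_L_W, hc n m hn hm, zero_smul, add_zero]
    exact Submodule.smul_mem _ _ (hW n m hn hm)
  · rw [lie_W_L, hc m n hm hn, zero_smul, add_zero]
    exact Submodule.neg_mem _ (Submodule.smul_mem _ _ (hW m n hm hn))
  · rw [lie_W_W]
    exact Submodule.zero_mem _

/-- The subalgebra `W(2,2)_+`, the linear span of the `L n` and `W n` with `n > 0`. -/
noncomputable def positivePart : LieSubalgebra ℂ W22 where
  toSubmodule := Submodule.span ℂ posGenerators
  lie_mem' {x y} hx hy := by
    change x ∈ Submodule.span ℂ posGenerators at hx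
    change y ∈ Submodule.span ℂ posGenerators at hy
    change ⁅x, y⁆ ∈ Submodule.span ℂ posGenerators
    induction hx using Submodule.span_induction with
    | zero => rw [zero_lie]; exact Submodule.zero_mem _
    | add x x' _ _ hx hx' => rw [add_lie]; exact Submodule.add_mem _ hx hx'
    | smul c x _ hx => rw [smul_lie]; exact Submodule.smul_mem _ _ hx
    | mem x hx =>
      induction hy using Submodule.span_induction with
      | zero => rw [lie_zero]; exact Submodule.zero_mem _
      | add y y' _ _ hy hy' => rw [lie_add]; exact Submodule.add_mem _ hy hy'
      | smul c y _ hy => rw [lie_smul]; exact Submodule.smul_mem _ _ hy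
      | mem y hy => exact lie_mem_span_posGenerators hx hy

/-- `L n` for `n > 0`, as an element of the positive part. -/
noncomputable def posL (n : ℤ) (hn : 0 < n) : positivePart :=
  ⟨L n, Submodule.subset_span ⟨n, hn, Or.inl rfl⟩⟩

/-- `W n` for `n > 0`, as an element of the positive part. -/
noncomputable def posW (n : ℤ) (hn : 0 < n) : positivePart :=
  ⟨W n, Submodule.subset_span ⟨n, hn, Or.inr rfl⟩⟩

/-- A Lie algebra homomorphism `φ : W(2,2)_+ → ℂ` is non-singular if
`φ(L i) φ(W i) ≠ 0` for `i = 1, 2`. -/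
def IsNonsingular (φ : LieAlgebra.LieCharacter ℂ positivePart) : Prop :=
  φ (posL 1 one_pos) * φ (posW 1 one_pos) ≠ 0 ∧ φ (posL 2 two_pos) * φ (posW 2 two_pos) ≠ 0

section Modules

attribute [local instance 100] LieRing.ofAssociativeRing

variable {V : Type*} [AddCommGroup V] [Module ℂ V] [LieRingModule W22 V] [LieModule ℂ W22 V]

/-- `v` is a Whittaker vector of type `φ`: `x v = φ(x) v` for all `x` in the positive part. -/
def IsWhittakerVector (φ : LieAlgebra.LieCharacter ℂ positivePart) (v : V) : Prop :=
  ∀ x : positivePart, ⁅(x : W22), v⁆ = φ x • v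

/-- `V` is a Whittaker module of type `φ` with cyclic Whittaker vector `v`: `φ` is non-singular,
and `v` is a Whittaker vector of type `φ` which generates `V`. -/
def IsCyclicWhittakerVector (φ : LieAlgebra.LieCharacter ℂ positivePart) (v : V) : Prop :=
  IsNonsingular φ ∧ IsWhittakerVector φ v ∧ LieSubmodule.lieSpan ℂ W22 {v} = ⊤

/-- The action `p(z) v` on `V` of a polynomial `p(z)` in the central element `z`. -/
noncomputable def polyAct (p : ℂ[X]) (v : V) : V :=
  Polynomial.aeval (LieModule.toEnd ℂ W22 V z) p v

/-- The annihilator of `v` in the algebra `S(z) = ℂ[z]`. -/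
noncomputable def annZ (v : V) : Ideal ℂ[X] where
  carrier := {p | polyAct p v = 0}
  zero_mem' := by simp [polyAct]
  add_mem' {p q} hp hq := by
    simp only [Set.mem_ofPred_eq, polyAct] at hp hq ⊢
    rw [map_add, LinearMap.add_apply, hp, hq, add_zero]
  smul_mem' c p hp := by
    simp only [Set.mem_ofPred_eq, polyAct, smul_eq_mul] at hp ⊢
    rw [map_mul, Module.End.mul_apply, hp, map_zero]

/-- The submodule `U(W(2,2)) v` of `V` generated by `v`. -/
noncomputable def cyclicSubmodule (v : V) : LieSubmodule ℂ W22 V := LieSubmodule.lieSpan ℂ W22 {v}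

/-- The cyclic submodule is `U(W(2,2)) v`, with the action of the universal enveloping algebra
that extends the given one. -/
theorem mem_cyclicSubmodule_iff (v x : V) :
    x ∈ cyclicSubmodule v ↔ ∃ u : UniversalEnvelopingAlgebra ℂ W22,
      UniversalEnvelopingAlgebra.lift ℂ (LieModule.toEnd ℂ W22 V) u v = x := by
  have key : ∀ (N : LieSubmodule ℂ W22 V) (t : TensorAlgebra ℂ W22) (y : V), y ∈ N →
      UniversalEnvelopingAlgebra.lift ℂ (LieModule.toEnd ℂ W22 V)
        (UniversalEnvelopingAlgebra.mkAlgHom ℂ W22 t) y ∈ N := by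
    intro N t
    induction t using TensorAlgebra.induction with
    | algebraMap r =>
      intro y hy
      rw [AlgHom.commutes, AlgHom.commutes, Module.algebraMap_end_apply]
      exact N.smul_mem r hy
    | ι g =>
      intro y hy
      have h := UniversalEnvelopingAlgebra.lift_ι_apply ℂ (LieModule.toEnd ℂ W22 V) g
      rw [UniversalEnvelopingAlgebra.ι_apply] at h
      rw [h]
      exact N.lie_mem hy
    | mul a b ha hb =>
      intro y hy
      rw [map_mul, map_mul, Module.End.mul_apply]
      exact ha _ (hb _ hy)
    | add a b ha hb =>
      intro y hy
      rw [map_add, map_add, LinearMap.add_apply]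
      exact N.add_mem (ha _ hy) (hb _ hy)
  constructor
  · intro hx
    refine LieSubmodule.lieSpan_induction (R := ℂ) (L := W22)
      (p := fun x _ => ∃ u : UniversalEnvelopingAlgebra ℂ W22,
        UniversalEnvelopingAlgebra.lift ℂ (LieModule.toEnd ℂ W22 V) u v = x)
      ?_ ?_ ?_ ?_ ?_ hx
    · rintro y rfl
      exact ⟨1, by rw [map_one, Module.End.one_apply]⟩
    · exact ⟨0, by rw [map_zero, LinearMap.zero_apply]⟩
    · rintro _ _ _ _ ⟨u, rfl⟩ ⟨u', rfl⟩
      exact ⟨u + u', by rw [map_add, LinearMap.add_apply]⟩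
    · rintro c _ _ ⟨u, rfl⟩
      exact ⟨c • u, by rw [map_smul, LinearMap.smul_apply]⟩
    · rintro g _ _ ⟨u, rfl⟩
      refine ⟨UniversalEnvelopingAlgebra.ι ℂ g * u, ?_⟩
      rw [map_mul, UniversalEnvelopingAlgebra.lift_ι_apply, Module.End.mul_apply]
      rfl
  · rintro ⟨u, rfl⟩
    obtain ⟨t, rfl⟩ := RingCon.mk'_surjective _ u
    exact key (cyclicSubmodule v) t v (LieSubmodule.subset_lieSpan (Set.mem_singleton v))

/-- `v` as an element of the submodule that it generates. -/
noncomputable def cyclicGenerator (v : V) : cyclicSubmodule v :=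
  ⟨v, LieSubmodule.subset_lieSpan (Set.mem_singleton v)⟩

variable (V)

/-- A module is indecomposable if it is nonzero and is not the internal direct sum of two nonzero
submodules. -/
def IsIndecomposable : Prop :=
  Nontrivial V ∧ ∀ N₁ N₂ : LieSubmodule ℂ W22 V, IsCompl N₁ N₂ → N₁ = ⊥ ∨ N₂ = ⊥

/-- A module has composition length `n` if it has a composition series
`0 = N 0 ⊂ N 1 ⊂ ⋯ ⊂ N n = V`, where each `N i` is a maximal proper submodule of `N (i + 1)`. -/
def HasCompositionLength (n : ℕ) : Prop :=
  ∃ N : Fin (n + 1) → LieSubmodule ℂ W22 V,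
    N 0 = ⊥ ∧ N (Fin.last n) = ⊤ ∧ ∀ i : Fin n, N i.castSucc ⋖ N i.succ

end Modules

end W22

/-! Since `z` is central, every polynomial in `z` acts on `V` by a module endomorphism, so `q(z) V`
is the submodule generated by `q(z) w`. In particular `p(z)` kills `V`, and `V_j` is the image of
`V` under the product of the other factors. It is killed by `(z - ξ_j)^{a_j}`, so it lies in the
generalized eigenspace of `z` for `ξ_j`. Independence of these eigenspaces together with a Bézout
identity gives the direct sum.

The remaining claims reduce to one fact, `IsScalarWhittaker.eq_bot_or_eq_top`: if `z` acts by a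
scalar, a cyclic Whittaker module has no proper nonzero submodule. Applied to `V ⧸ (z - ξ)V` it
shows that nothing lies strictly between `(z - ξ)V` and `V`. On a module killed by a power of `z -
ξ`, the images of the successive powers then form a composition series, and a Nakayama argument
gives indecomposability.

The fact itself is proved by lowering a nonzero vector of a submodule `N` to a multiple of `w`
without leaving `N`, in two stages. Modulo brackets, `φ(W n) = 0` for `n ≥ 3`, while `φ(W 2) ≠ 0`.
So `W (n + 2) - φ(W (n + 2))` behaves like a derivative in `L (-n)`: its bracket with `L (-n)` is
`-(2n + 2) W 2`, and with `L (-m)`, `m < n`, a multiple of some `W i` with `i ≥ 3`. This removes all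
`L`'s. Next, `L (M + 2) - φ(L (M + 2))` behaves like a derivative in `W (-M)` and removes the `W`'s
one index at a time. Characteristic zero makes these derivatives detect leading terms, which is
`mem_of_smul_add_raise_lower_mem`. -/

/-! ### Abstract lowering arguments on filtered vector spaces -/

section Lowering

variable {V : Type*} [AddCommGroup V] [Module ℂ V]

/-- If `T` lowers and `X` raises an exhaustive filtration by one step and `[T, X] = c` up to
lowering terms, then `X T` has no eigenvalue `-(d + 1) c` on the graded pieces. -/
theorem mem_of_smul_add_raise_lower_mem {F : ℕ → Submodule ℂ V} {X T : Module.End ℂ V} {c : ℂ}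
    (hc : c ≠ 0) (hX : ∀ k, ∀ v ∈ F k, X v ∈ F (k + 1)) (h0 : F 0 = ⊥)
    (hT : ∀ k, ∀ v ∈ F (k + 1), T v ∈ F k)
    (hTX : ∀ k, ∀ v ∈ F (k + 1), T (X v) - X (T v) - c • v ∈ F k) (k d : ℕ) (u : V)
    (hu : u ∈ F (k + 1)) (h : (((d : ℂ) + 1) * c) • u + X (T u) ∈ F k) : u ∈ F k := by
  have hd : ∀ d : ℕ, ((d : ℂ) + 1) * c ≠ 0 := fun d => mul_ne_zero (Nat.cast_add_one_ne_zero d) hc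
  suffices hXT : X (T u) ∈ F k by
    have := (F k).sub_mem h hXT
    rw [add_sub_cancel_right] at this
    exact ((F k).smul_mem_iff (hd d)).1 this
  induction k generalizing u d with
  | zero =>
    have := hT 0 u hu
    rw [h0, Submodule.mem_bot] at this
    rw [this, map_zero]
    exact Submodule.zero_mem _
  | succ k ih =>
    refine hX k _ ?_
    have h1 := hT k _ h
    have h2 := hTX k _ (hT _ u hu)
    -- Moving `T` past `X` contributes one more `c`, so `T u` satisfies the same hypothesis with `d
    -- + 1`. This is why `d` is kept general, and in characteristic zero the coefficient never
    -- vanishes.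
    have h3 : ((((d + 1 : ℕ) : ℂ) + 1) * c) • T u + X (T (T u)) ∈ F k := by
      have := (F k).sub_mem h1 h2
      rw [map_add, map_smul] at this
      convert this using 1
      push_cast
      module
    have h4 := ih (d + 1) (T u) (hT _ u hu) h3
    have := (F k).sub_mem h3 h4
    rw [add_sub_cancel_right] at this
    exact ((F k).smul_mem_iff (hd _)).1 this

/-- The filtration of the span of `B` under the operators `X m`, by the number of operators. -/
def opFiltration (B : Submodule ℂ V) (X : ℕ → Module.End ℂ V) : ℕ → Submodule ℂ V
  | 0 => ⊥
  | k + 1 => B ⊔ opFiltration B X k ⊔ ⨆ m, (opFiltration B X k).map (X m)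

/-- The part of `opFiltration B X k` whose leading terms involve only the `X m` with `m < M`. -/
def boundedFiltration (B : Submodule ℂ V) (X : ℕ → Module.End ℂ V) (M : ℕ) : ℕ → Submodule ℂ V
  | 0 => ⊥
  | k + 1 => B ⊔ opFiltration B X k ⊔
      ⨆ m, ⨆ (_ : m < M), (boundedFiltration B X M k).map (X m)

variable {B : Submodule ℂ V} {X : ℕ → Module.End ℂ V}

theorem opFiltration_mono (k : ℕ) : opFiltration B X k ≤ opFiltration B X (k + 1) := by
  rw [opFiltration]
  exact le_sup_of_le_left le_sup_right

theorem apply_mem_opFiltration (m k : ℕ) (v : V) (hv : v ∈ opFiltration B X k) :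
    X m v ∈ opFiltration B X (k + 1) := by
  rw [opFiltration]
  exact Submodule.mem_sup_right (Submodule.mem_iSup_of_mem m (Submodule.mem_map_of_mem hv))

theorem le_opFiltration (k : ℕ) : B ≤ opFiltration B X (k + 1) := by
  rw [opFiltration]
  exact le_sup_of_le_left le_sup_left

theorem opFiltration_one : opFiltration B X 1 = B := by
  simp [opFiltration]

theorem opFiltration_succ_le {k : ℕ} {P : Submodule ℂ V} (hB : B ≤ P)
    (hF : opFiltration B X k ≤ P) (hX : ∀ m, ∀ v ∈ opFiltration B X k, X m v ∈ P) :
    opFiltration B X (k + 1) ≤ P := by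
  rw [opFiltration]
  refine sup_le (sup_le hB hF) (iSup_le fun m => ?_)
  rw [Submodule.map_le_iff_le_comap]
  exact hX m

theorem le_boundedFiltration (M k : ℕ) : B ≤ boundedFiltration B X M (k + 1) := by
  rw [boundedFiltration]
  exact le_sup_of_le_left le_sup_left

theorem opFiltration_le_boundedFiltration (M k : ℕ) :
    opFiltration B X k ≤ boundedFiltration B X M (k + 1) := by
  rw [boundedFiltration]
  exact le_sup_of_le_left le_sup_right

theorem apply_mem_boundedFiltration {M m : ℕ} (hm : m < M) (k : ℕ) (v : V)
    (hv : v ∈ boundedFiltration B X M k) : X m v ∈ boundedFiltration B X M (k + 1) := by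
  rw [boundedFiltration]
  exact Submodule.mem_sup_right (Submodule.mem_iSup_of_mem m
    (Submodule.mem_iSup_of_mem hm (Submodule.mem_map_of_mem hv)))

theorem boundedFiltration_succ_le {M k : ℕ} {P : Submodule ℂ V} (hB : B ≤ P)
    (hF : opFiltration B X k ≤ P)
    (hX : ∀ m < M, ∀ v ∈ boundedFiltration B X M k, X m v ∈ P) :
    boundedFiltration B X M (k + 1) ≤ P := by
  rw [boundedFiltration]
  refine sup_le (sup_le hB hF) (iSup_le fun m => iSup_le fun hm => ?_)
  rw [Submodule.map_le_iff_le_comap]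
  exact hX m hm

theorem boundedFiltration_le (M k : ℕ) : boundedFiltration B X M k ≤ opFiltration B X k := by
  induction k with
  | zero => exact bot_le
  | succ k ih =>
    exact boundedFiltration_succ_le (le_opFiltration k) (opFiltration_mono k)
      fun m _ v hv => apply_mem_opFiltration m k v (ih hv)

theorem boundedFiltration_mono (k : ℕ) : Monotone fun M => boundedFiltration B X M k := by
  intro M M' h
  induction k with
  | zero => exact le_rfl
  | succ k ih =>
    exact boundedFiltration_succ_le (le_boundedFiltration M' k)
      (opFiltration_le_boundedFiltration M' k)
      fun m hm v hv => apply_mem_boundedFiltration (hm.trans_le h) k v (ih hv)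

theorem exists_mem_boundedFiltration {k : ℕ} {v : V} (hv : v ∈ opFiltration B X k) :
    ∃ M, v ∈ boundedFiltration B X M k := by
  have hdir := fun k => (boundedFiltration_mono (B := B) (X := X) k).directed_le
  suffices h : opFiltration B X k ≤ ⨆ M, boundedFiltration B X M k from
    (Submodule.mem_iSup_of_directed _ (hdir k)).1 (h hv)
  clear hv
  induction k with
  | zero => exact bot_le
  | succ k ih =>
    refine opFiltration_succ_le ((le_boundedFiltration 0 k).trans
        (le_iSup (fun M => boundedFiltration B X M (k + 1)) 0))
      ((opFiltration_le_boundedFiltration 0 k).trans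
        (le_iSup (fun M => boundedFiltration B X M (k + 1)) 0)) fun m v hv => ?_
    obtain ⟨M, hM⟩ := (Submodule.mem_iSup_of_directed _ (hdir k)).1 (ih hv)
    exact Submodule.mem_iSup_of_mem (max M (m + 1)) (apply_mem_boundedFiltration
      (by omega) k v (boundedFiltration_mono k (le_max_left _ _) hM))

/-- The operators commute modulo lower terms, so one occurrence of `X M` in a leading term can be
moved to the far left. -/
theorem boundedFiltration_succ_le_sup
    (hXX : ∀ a b k, ∀ v ∈ opFiltration B X k, X a (X b v) - X b (X a v) ∈ opFiltration B X (k + 1))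
    (M k : ℕ) : boundedFiltration B X (M + 1) (k + 1) ≤
      boundedFiltration B X M (k + 1) ⊔ (opFiltration B X k).map (X M) := by
  induction k with
  | zero =>
    refine boundedFiltration_succ_le (le_sup_of_le_left (le_boundedFiltration M 0)) bot_le
      fun m _ v hv => ?_
    rw [(Submodule.mem_bot ℂ).1 hv, map_zero]
    exact Submodule.zero_mem _
  | succ k ih =>
    refine boundedFiltration_succ_le (le_sup_of_le_left (le_boundedFiltration M _))
      (le_sup_of_le_left (opFiltration_le_boundedFiltration M _)) fun m hm v hv => ?_
    rcases Nat.lt_succ_iff_lt_or_eq.1 hm with hm | rfl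
    · obtain ⟨b, hb, x, ⟨u, hu, rfl⟩, rfl⟩ := Submodule.mem_sup.1 (ih hv)
      have h1 : X m b + (X m (X M u) - X M (X m u)) ∈ boundedFiltration B X M (k + 1 + 1) :=
        Submodule.add_mem _ (apply_mem_boundedFiltration hm _ _ hb)
          (opFiltration_le_boundedFiltration M _ (hXX m M k u hu))
      have h2 := Submodule.mem_map_of_mem (f := X M) (apply_mem_opFiltration m k u hu)
      convert Submodule.add_mem_sup h1 h2 using 1
      rw [map_add]
      abel
    · exact Submodule.mem_sup_right (Submodule.mem_map_of_mem (boundedFiltration_le _ _ hv))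

/-- The commutator of `T M` with `X m`, `m < M`, falls two filtration steps below `X m v`, so `T M`
loses two steps here instead of one. For `k = 0` the truncated `k - 1` is harmless, because `T M`
kills `B`. -/
theorem lower_mem_of_mem_boundedFiltration {T : ℕ → Module.End ℂ V}
    (hT : ∀ n k, ∀ v ∈ opFiltration B X (k + 1), T n v ∈ opFiltration B X k)
    (hTX : ∀ n k, ∀ m < n, ∀ v ∈ opFiltration B X (k + 1),
      T n (X m v) - X m (T n v) ∈ opFiltration B X k)
    (M k : ℕ) (v : V) (hv : v ∈ boundedFiltration B X M (k + 1)) :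
    T M v ∈ opFiltration B X (k - 1) := by
  induction k generalizing v with
  | zero => exact hT M 0 v (boundedFiltration_le _ _ hv)
  | succ k ih =>
    suffices h : boundedFiltration B X M (k + 1 + 1) ≤ (opFiltration B X k).comap (T M) from h hv
    refine boundedFiltration_succ_le (fun v hv => hT M k v (le_opFiltration k hv))
      (fun v hv => hT M k v hv) fun m hm v hv => ?_
    have h1 : X m (T M v) ∈ opFiltration B X k := by
      cases k with
      | zero =>
        have := hT M 0 v (boundedFiltration_le _ _ hv)
        rw [(Submodule.mem_bot ℂ).1 this, map_zero]
        exact Submodule.zero_mem _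
      | succ k => exact apply_mem_opFiltration m _ _ (ih v hv)
    have := Submodule.add_mem _ (hTX M k m hm v (boundedFiltration_le _ _ hv)) h1
    rwa [sub_add_cancel] at this

/-- If lowering operators `T n` are dual to the `X n` up to triangular and lowering terms, their
common kernel is the bottom piece of the filtration. -/
theorem mem_of_forall_lower_eq_zero {T : ℕ → Module.End ℂ V} {c : ℕ → ℂ} (hc : ∀ n, c n ≠ 0)
    (hXX : ∀ a b k, ∀ v ∈ opFiltration B X k, X a (X b v) - X b (X a v) ∈ opFiltration B X (k + 1))
    (hT : ∀ n k, ∀ v ∈ opFiltration B X (k + 1), T n v ∈ opFiltration B X k)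
    (hTX : ∀ n k, ∀ m < n, ∀ v ∈ opFiltration B X (k + 1),
      T n (X m v) - X m (T n v) ∈ opFiltration B X k)
    (hTXc : ∀ n k, ∀ v ∈ opFiltration B X (k + 1),
      T n (X n v) - X n (T n v) - c n • v ∈ opFiltration B X k)
    {k : ℕ} {v : V} (hv : v ∈ opFiltration B X k) (h : ∀ n, T n v = 0) : v ∈ B := by
  induction k with
  | zero =>
    rw [(Submodule.mem_bot ℂ).1 hv]
    exact Submodule.zero_mem _
  | succ k ih =>
    obtain ⟨M, hM⟩ := exists_mem_boundedFiltration hv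
    -- Strip the largest index. If `v = b + X M u`, then `T M b` drops two steps, so `T M v = 0`
    -- forces `c M • u + X M (T M u)` to be of lower order. The eigenvalue lemma with `d = 0` then
    -- lowers `u` itself, and `X M u` is no longer a leading term.
    have h0 : v ∈ boundedFiltration B X 0 (k + 1) := by
      clear hv
      induction M with
      | zero => exact hM
      | succ M ihM =>
        refine ihM ?_
        obtain ⟨b, hb, x, ⟨u, hu, rfl⟩, rfl⟩ :=
          Submodule.mem_sup.1 (boundedFiltration_succ_le_sup hXX M k hM)
        refine Submodule.add_mem _ hb ?_
        cases k with
        | zero =>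
          rw [(Submodule.mem_bot ℂ).1 hu, map_zero]
          exact Submodule.zero_mem _
        | succ k =>
          refine opFiltration_le_boundedFiltration M _ (apply_mem_opFiltration M k u ?_)
          refine mem_of_smul_add_raise_lower_mem (hc M) (apply_mem_opFiltration M) rfl (hT M)
            (hTXc M) k 0 u hu ?_
          have h1 := lower_mem_of_mem_boundedFiltration hT hTX M _ b hb
          rw [Nat.add_sub_cancel] at h1
          have h2 := Submodule.add_mem _ h1 (hTXc M k u hu)
          have h3 := h M
          rw [map_add] at h3
          rw [← Submodule.neg_mem_iff]
          convert h2 using 1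
          rw [eq_neg_of_add_eq_zero_left h3]
          simp only [Nat.cast_zero]
          module
    -- With no index allowed, only `B` and the previous filtration step remain.
    rw [boundedFiltration] at h0
    simp only [not_lt_zero, iSup_false, iSup_bot, sup_bot_eq] at h0
    cases k with
    | zero => simpa [opFiltration] using h0
    | succ k => exact ih (by rwa [sup_eq_right.2 (le_opFiltration k)] at h0)

/-- Keep applying a `T n` that does not kill the vector. Each application lowers the filtration
degree inside `N`, so the process ends at a nonzero vector in the common kernel, hence in `B`. -/
theorem exists_ne_zero_mem_of_lower_stable {T : ℕ → Module.End ℂ V} {c : ℕ → ℂ}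
    (hc : ∀ n, c n ≠ 0)
    (hXX : ∀ a b k, ∀ v ∈ opFiltration B X k, X a (X b v) - X b (X a v) ∈ opFiltration B X (k + 1))
    (hT : ∀ n k, ∀ v ∈ opFiltration B X (k + 1), T n v ∈ opFiltration B X k)
    (hTX : ∀ n k, ∀ m < n, ∀ v ∈ opFiltration B X (k + 1),
      T n (X m v) - X m (T n v) ∈ opFiltration B X k)
    (hTXc : ∀ n k, ∀ v ∈ opFiltration B X (k + 1),
      T n (X n v) - X n (T n v) - c n • v ∈ opFiltration B X k)
    {N : Submodule ℂ V} (hN : ∀ n, ∀ v ∈ N, T n v ∈ N) {k : ℕ} {v : V}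
    (hv : v ∈ opFiltration B X k) (hvN : v ∈ N) (hv0 : v ≠ 0) : ∃ u ∈ B, u ∈ N ∧ u ≠ 0 := by
  induction k generalizing v with
  | zero => exact absurd ((Submodule.mem_bot ℂ).1 hv) hv0
  | succ k ih =>
    by_cases h : ∀ n, T n v = 0
    · exact ⟨v, mem_of_forall_lower_eq_zero hc hXX hT hTX hTXc hv h, hvN, hv0⟩
    · obtain ⟨n, hn⟩ := not_forall.1 h
      exact ih (hT n k v hv) (hN n v hvN) hn

/-- The filtration by powers of `X` of the span of `B` under `X`. -/
def powFiltration (B : Submodule ℂ V) (X : Module.End ℂ V) : ℕ → Submodule ℂ V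
  | 0 => ⊥
  | k + 1 => B ⊔ (powFiltration B X k).map X

theorem powFiltration_mono (B : Submodule ℂ V) (X : Module.End ℂ V) :
    Monotone (powFiltration B X) := by
  refine monotone_nat_of_le_succ fun k => ?_
  induction k with
  | zero => exact bot_le
  | succ k ih => exact sup_le_sup_left (Submodule.map_mono ih) B

theorem apply_mem_powFiltration {B : Submodule ℂ V} {X : Module.End ℂ V} {k : ℕ} {v : V}
    (hv : v ∈ powFiltration B X k) : X v ∈ powFiltration B X (k + 1) :=
  Submodule.mem_sup_right (Submodule.mem_map_of_mem hv)

theorem powFiltration_stable {B : Submodule ℂ V} {X Y : Module.End ℂ V}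
    (hB : ∀ v ∈ B, Y v ∈ B) (hXY : ∀ v, Y (X v) = X (Y v)) (k : ℕ) :
    ∀ v ∈ powFiltration B X k, Y v ∈ powFiltration B X k := by
  induction k with
  | zero =>
    intro v hv
    rw [(Submodule.mem_bot ℂ).1 hv, map_zero]
    exact Submodule.zero_mem _
  | succ k ih =>
    intro v hv
    obtain ⟨b, hb, x, ⟨u, hu, rfl⟩, rfl⟩ := Submodule.mem_sup.1 hv
    rw [map_add, hXY]
    exact Submodule.add_mem_sup (hB b hb) (Submodule.mem_map_of_mem (ih u hu))

/-- Here `T` acts as `c` times differentiation of polynomials in `X` with coefficients in `B`. A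
vector killed by `T` has no leading term of positive degree, and any other vector drops in degree
under `T`. -/
theorem exists_ne_zero_mem_of_mem_powFiltration {B : Submodule ℂ V} {X T : Module.End ℂ V} {c : ℂ}
    (hc : c ≠ 0) (hB : ∀ v ∈ B, T v = 0)
    (hTX : ∀ k, ∀ v ∈ powFiltration B X k, T (X v) - X (T v) = c • v)
    {N : Submodule ℂ V} (hN : ∀ v ∈ N, T v ∈ N) {k : ℕ} {v : V}
    (hv : v ∈ powFiltration B X k) (hvN : v ∈ N) (hv0 : v ≠ 0) : ∃ u ∈ B, u ∈ N ∧ u ≠ 0 := by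
  have hT : ∀ k, ∀ v ∈ powFiltration B X (k + 1), T v ∈ powFiltration B X k := by
    intro k
    induction k with
    | zero =>
      intro v hv
      rw [powFiltration, powFiltration, Submodule.map_bot, sup_bot_eq] at hv
      exact (Submodule.mem_bot ℂ).2 (hB v hv)
    | succ k ih =>
      intro v hv
      obtain ⟨b, hb, x, ⟨u, hu, rfl⟩, rfl⟩ := Submodule.mem_sup.1 hv
      rw [map_add, hB b hb, zero_add, sub_eq_iff_eq_add.1 (hTX _ u hu)]
      exact Submodule.add_mem _ (Submodule.smul_mem _ _ hu) (apply_mem_powFiltration (ih u hu))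
  induction k generalizing v with
  | zero => exact absurd ((Submodule.mem_bot ℂ).1 hv) hv0
  | succ k ih =>
    by_cases h : T v = 0
    · cases k with
      | zero =>
        rw [powFiltration, powFiltration, Submodule.map_bot, sup_bot_eq] at hv
        exact ⟨v, hv, hvN, hv0⟩
      | succ k =>
        refine ih ?_ hvN hv0
        obtain ⟨b, hb, x, ⟨u, hu, rfl⟩, rfl⟩ := Submodule.mem_sup.1 hv
        refine Submodule.add_mem_sup hb (Submodule.mem_map_of_mem ?_)
        refine mem_of_smul_add_raise_lower_mem (F := powFiltration B X) hc
          (fun k v hv => apply_mem_powFiltration hv) rfl hT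
          (fun k v hv => ?_) k 0 u hu ?_
        · rw [hTX _ v hv, sub_self]
          exact Submodule.zero_mem _
        · rw [map_add, hB b hb, zero_add, sub_eq_iff_eq_add.1 (hTX _ u hu)] at h
          rw [Nat.cast_zero, zero_add, one_mul, h]
          exact Submodule.zero_mem _
    · exact ih (hT k v hv) (hN v hvN) h

end Lowering

/-! ### Simplicity when `z` acts by a scalar -/

namespace W22

section Simple

variable {V : Type*} [AddCommGroup V] [Module ℂ V] [LieRingModule W22 V] [LieModule ℂ W22 V]

/-- `w` generates `V`, the positive part acts on `w` by the scalars `lam n`, `mu n`, where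
`mu 2 ≠ 0` and `mu n = 0` for `n ≥ 3`, and `z` acts on `V` by the scalar `ξ`. -/
structure IsScalarWhittaker (lam mu : ℤ → ℂ) (ξ : ℂ) (w : V) : Prop where
  lie_L : ∀ n : ℤ, 0 < n → ⁅L n, w⁆ = lam n • w
  lie_W : ∀ n : ℤ, 0 < n → ⁅W n, w⁆ = mu n • w
  mu_two : mu 2 ≠ 0
  mu_eq_zero : ∀ n : ℤ, 3 ≤ n → mu n = 0
  lie_z : ∀ v : V, ⁅z, v⁆ = ξ • v
  lieSpan_eq_top : LieSubmodule.lieSpan ℂ W22 {w} = ⊤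

theorem cocycle_of_ne {n m : ℤ} (h : m + n ≠ 0) : cocycle n m = 0 := if_neg h

theorem lie_W_lie_W (n m : ℤ) (v : V) : ⁅W n, ⁅W m, v⁆⁆ = ⁅W m, ⁅W n, v⁆⁆ := by
  rw [leibniz_lie, lie_W_W, zero_lie, zero_add]

theorem lie_L_lie_L (n m : ℤ) (v : V) :
    ⁅L n, ⁅L m, v⁆⁆ = ((m : ℂ) - n) • ⁅L (m + n), v⁆ + cocycle n m • ⁅z, v⁆ + ⁅L m, ⁅L n, v⁆⁆ := by
  rw [leibniz_lie, lie_L_L, add_lie, smul_lie, smul_lie]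

theorem lie_L_lie_W (n m : ℤ) (v : V) :
    ⁅L n, ⁅W m, v⁆⁆ = ((m : ℂ) - n) • ⁅W (m + n), v⁆ + cocycle n m • ⁅z, v⁆ + ⁅W m, ⁅L n, v⁆⁆ := by
  rw [leibniz_lie, lie_L_W, add_lie, smul_lie, smul_lie]

theorem lie_W_lie_L (n m : ℤ) (v : V) :
    ⁅W n, ⁅L m, v⁆⁆ =
      ((m : ℂ) - n) • ⁅W (n + m), v⁆ - cocycle m n • ⁅z, v⁆ + ⁅L m, ⁅W n, v⁆⁆ := by
  rw [leibniz_lie, lie_W_L, neg_lie, add_lie, smul_lie, smul_lie]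
  module

/-- A subspace stable under the basis elements of `W(2,2)` is a submodule. -/
theorem lie_mem_of_forall_basis {P : Submodule ℂ V} (hL : ∀ n, ∀ v ∈ P, ⁅L n, v⁆ ∈ P)
    (hW : ∀ n, ∀ v ∈ P, ⁅W n, v⁆ ∈ P) (hz : ∀ v ∈ P, ⁅(z : W22), v⁆ ∈ P) (x : W22) {v : V}
    (hv : v ∈ P) : ⁅x, v⁆ ∈ P := by
  induction basis.mem_span x using Submodule.span_induction with
  | zero => rw [zero_lie]; exact P.zero_mem
  | add x x' _ _ hx hx' => rw [add_lie]; exact P.add_mem hx hx'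
  | smul c x _ hx => rw [smul_lie]; exact P.smul_mem c hx
  | mem x hx =>
    obtain ⟨i, rfl⟩ := hx
    cases i with
    | L n => exact hL n v hv
    | W n => exact hW n v hv
    | z => exact hz v hv

/-- The smallest subspace containing `w` that is stable under the `W n` with `n ∈ S`. -/
def spanW (S : Set ℤ) (w : V) : Submodule ℂ V :=
  sInf {P | w ∈ P ∧ ∀ n ∈ S, ∀ v ∈ P, ⁅W n, v⁆ ∈ P}

theorem mem_spanW (S : Set ℤ) (w : V) : w ∈ spanW S w :=
  Submodule.mem_sInf.2 fun _ hP => hP.1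

theorem lie_mem_spanW {S : Set ℤ} {w : V} {n : ℤ} (hn : n ∈ S) {v : V} (hv : v ∈ spanW S w) :
    ⁅W n, v⁆ ∈ spanW S w :=
  Submodule.mem_sInf.2 fun P hP => hP.2 n hn v (Submodule.mem_sInf.1 hv P hP)

theorem spanW_le {S : Set ℤ} {w : V} {P : Submodule ℂ V} (hw : w ∈ P)
    (hP : ∀ n ∈ S, ∀ v ∈ P, ⁅W n, v⁆ ∈ P) : spanW S w ≤ P := sInf_le ⟨hw, hP⟩

theorem spanW_mono {S S' : Set ℤ} (h : S ⊆ S') (w : V) : spanW S w ≤ spanW S' w :=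
  spanW_le (mem_spanW S' w) fun _ hn _ hv => lie_mem_spanW (h hn) hv

namespace IsScalarWhittaker

variable {lam mu : ℤ → ℂ} {ξ : ℂ} {w : V}

/-- The `W`'s commute, so the eigenvalue at `w` propagates to everything they generate from it. -/
theorem lie_W_of_mem (h : IsScalarWhittaker lam mu ξ w) {n : ℤ} (hn : 0 < n) {S : Set ℤ} {v : V}
    (hv : v ∈ spanW S w) : ⁅W n, v⁆ = mu n • v := by
  have : spanW S w ≤ LinearMap.ker (LieModule.toEnd ℂ W22 V (W n) - mu n • LinearMap.id) :=
    spanW_le (by simp [h.lie_W n hn]) fun m _ v hv => by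
      simp only [LinearMap.mem_ker, LinearMap.sub_apply, LieModule.toEnd_apply_apply,
        LinearMap.smul_apply, LinearMap.id_apply, sub_eq_zero] at hv ⊢
      rw [lie_W_lie_W, hv, lie_smul]
  simpa [sub_eq_zero] using this hv

theorem lie_L_mem_spanW (h : IsScalarWhittaker lam mu ξ w) {n : ℤ} (hn : 0 < n) {v : V}
    (hv : v ∈ spanW Set.univ w) : ⁅L n, v⁆ ∈ spanW Set.univ w := by
  have : spanW Set.univ w ≤
      spanW Set.univ w ⊓ (spanW Set.univ w).comap (LieModule.toEnd ℂ W22 V (L n)) :=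
    spanW_le ⟨mem_spanW _ w, by
      change ⁅L n, w⁆ ∈ spanW Set.univ w
      rw [h.lie_L n hn]
      exact Submodule.smul_mem _ _ (mem_spanW _ w)⟩ fun m _ v hv => by
        refine ⟨lie_mem_spanW (Set.mem_univ m) hv.1, ?_⟩
        change ⁅L n, ⁅W m, v⁆⁆ ∈ spanW Set.univ w
        rw [lie_L_lie_W, h.lie_z]
        exact Submodule.add_mem _ (Submodule.add_mem _
          (Submodule.smul_mem _ _ (lie_mem_spanW (Set.mem_univ _) hv.1))
          (Submodule.smul_mem _ _ (Submodule.smul_mem _ _ hv.1)))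
          (lie_mem_spanW (Set.mem_univ _) hv.2)
  exact (this hv).2

/-- The filtration of `V` by the number of operators `L n`, `n ≤ 0`. -/
noncomputable def filtrationL (w : V) : ℕ → Submodule ℂ V :=
  opFiltration (spanW Set.univ w) fun m => LieModule.toEnd ℂ W22 V (L (-(m : ℤ)))

theorem lie_L_neg_mem {m : ℤ} (hm : m ≤ 0) {k : ℕ} {v : V} (hv : v ∈ filtrationL w k) :
    ⁅L m, v⁆ ∈ filtrationL w (k + 1) := by
  obtain ⟨m, rfl⟩ : ∃ m' : ℕ, m = -(m' : ℤ) := ⟨m.natAbs, by omega⟩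
  exact apply_mem_opFiltration m k v hv

theorem filtrationL_mono (w : V) : Monotone (filtrationL w) :=
  monotone_nat_of_le_succ opFiltration_mono

/-- Induction step for stability properties of the filtration. -/
theorem filtrationL_succ_le {k : ℕ} {P : Submodule ℂ V} (h0 : spanW Set.univ w ≤ P)
    (h1 : filtrationL w k ≤ P) (h2 : ∀ m : ℤ, m ≤ 0 → ∀ v ∈ filtrationL w k, ⁅L m, v⁆ ∈ P) :
    filtrationL w (k + 1) ≤ P :=
  opFiltration_succ_le h0 h1 fun m v hv => h2 _ (by omega) v hv

/-- Brackets of `W`'s with `L`'s involve only `W`'s and `z`, so moving a `W` inward creates no new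
`L`. -/
theorem lie_W_mem_filtrationL (h : IsScalarWhittaker lam mu ξ w) (k : ℕ) (n : ℤ) {v : V}
    (hv : v ∈ filtrationL w k) : ⁅W n, v⁆ ∈ filtrationL w k := by
  induction k generalizing n v with
  | zero =>
    rw [(Submodule.mem_bot ℂ).1 hv, lie_zero]
    exact Submodule.zero_mem _
  | succ k ih =>
    suffices hle : filtrationL w (k + 1) ≤
      (filtrationL w (k + 1)).comap (LieModule.toEnd ℂ W22 V (W n)) from hle hv
    refine filtrationL_succ_le
      (fun v hv => le_opFiltration k (lie_mem_spanW (Set.mem_univ n) hv))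
      (fun v hv => filtrationL_mono w k.le_succ (ih n hv)) fun m hm v hv => ?_
    change ⁅W n, ⁅L m, v⁆⁆ ∈ filtrationL w (k + 1)
    rw [lie_W_lie_L, h.lie_z]
    have hle := filtrationL_mono w k.le_succ
    exact Submodule.add_mem _ (Submodule.sub_mem _ (Submodule.smul_mem _ _ (hle (ih _ hv)))
      (Submodule.smul_mem _ _ (Submodule.smul_mem _ _ (hle hv)))) (lie_L_neg_mem hm (ih n hv))

theorem lie_L_mem_filtrationL (h : IsScalarWhittaker lam mu ξ w) (k : ℕ) {n : ℤ} (hn : 0 < n)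
    {v : V} (hv : v ∈ filtrationL w k) : ⁅L n, v⁆ ∈ filtrationL w k := by
  induction k generalizing n v with
  | zero =>
    rw [(Submodule.mem_bot ℂ).1 hv, lie_zero]
    exact Submodule.zero_mem _
  | succ k ih =>
    suffices hle : filtrationL w (k + 1) ≤
      (filtrationL w (k + 1)).comap (LieModule.toEnd ℂ W22 V (L n)) from hle hv
    refine filtrationL_succ_le (fun v hv => le_opFiltration k (h.lie_L_mem_spanW hn hv))
      (fun v hv => filtrationL_mono w k.le_succ (ih hn hv)) fun m hm v hv => ?_
    change ⁅L n, ⁅L m, v⁆⁆ ∈ filtrationL w (k + 1)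
    rw [lie_L_lie_L, h.lie_z]
    have hle := filtrationL_mono w k.le_succ
    refine Submodule.add_mem _ (Submodule.add_mem _ (Submodule.smul_mem _ _ ?_)
      (Submodule.smul_mem _ _ (Submodule.smul_mem _ _ (hle hv)))) (lie_L_neg_mem hm (ih hn hv))
    rcases le_or_gt (m + n) 0 with hmn | hmn
    · exact lie_L_neg_mem hmn hv
    · exact hle (ih hmn hv)

/-- Commuting `W n` past an `L` replaces that `L` by a `W` and a scalar, which costs one filtration
step; once no `L` is left, `W n` acts exactly by `mu n`. -/
theorem lie_W_sub_smul_mem (h : IsScalarWhittaker lam mu ξ w) (k : ℕ) {n : ℤ} (hn : 0 < n) {v : V}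
    (hv : v ∈ filtrationL w (k + 1)) : ⁅W n, v⁆ - mu n • v ∈ filtrationL w k := by
  induction k generalizing v with
  | zero =>
    rw [filtrationL, opFiltration_one] at hv
    rw [h.lie_W_of_mem hn hv, sub_self]
    exact Submodule.zero_mem _
  | succ k ih =>
    suffices hle : filtrationL w (k + 1 + 1) ≤ (filtrationL w (k + 1)).comap
      (LieModule.toEnd ℂ W22 V (W n) - mu n • LinearMap.id) from hle hv
    have hle := filtrationL_mono w k.le_succ
    refine filtrationL_succ_le (fun v hv => ?_) (fun v hv => hle (ih hv)) fun m hm v hv => ?_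
    · change ⁅W n, v⁆ - mu n • v ∈ filtrationL w (k + 1)
      rw [h.lie_W_of_mem hn hv, sub_self]
      exact Submodule.zero_mem _
    · change ⁅W n, ⁅L m, v⁆⁆ - mu n • ⁅L m, v⁆ ∈ filtrationL w (k + 1)
      have h1 := lie_L_neg_mem hm (ih hv)
      have h2 : ((m : ℂ) - n) • ⁅W (n + m), v⁆ - cocycle m n • (ξ • v) ∈ filtrationL w (k + 1) :=
        Submodule.sub_mem _ (Submodule.smul_mem _ _ (h.lie_W_mem_filtrationL _ _ hv))
          (Submodule.smul_mem _ _ (Submodule.smul_mem _ _ hv))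
      convert Submodule.add_mem _ h2 h1 using 1
      rw [lie_W_lie_L, h.lie_z, lie_sub, lie_smul]
      abel

/-- The union of the filtration is a submodule containing the generator `w`. -/
theorem exists_mem_filtrationL (h : IsScalarWhittaker lam mu ξ w) (v : V) :
    ∃ k, v ∈ filtrationL w k := by
  have hdir : Directed (· ≤ ·) (filtrationL w) := (filtrationL_mono w).directed_le
  have hmem : ∀ {v}, v ∈ ⨆ k, filtrationL w k ↔ ∃ k, v ∈ filtrationL w k :=
    Submodule.mem_iSup_of_directed _ hdir
  let N : LieSubmodule ℂ W22 V :=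
    { toSubmodule := ⨆ k, filtrationL w k
      lie_mem := fun {x v} hv => by
        refine lie_mem_of_forall_basis (fun n v hv => ?_) (fun n v hv => ?_) (fun v hv => ?_) x hv
        · obtain ⟨k, hk⟩ := hmem.1 hv
          rcases le_or_gt n 0 with hn | hn
          · exact hmem.2 ⟨k + 1, lie_L_neg_mem hn hk⟩
          · exact hmem.2 ⟨k, h.lie_L_mem_filtrationL k hn hk⟩
        · obtain ⟨k, hk⟩ := hmem.1 hv
          exact hmem.2 ⟨k, h.lie_W_mem_filtrationL k n hk⟩
        · rw [h.lie_z]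
          exact Submodule.smul_mem _ _ hv }
  have hN : LieSubmodule.lieSpan ℂ W22 {w} ≤ N := by
    rw [LieSubmodule.lieSpan_le, Set.singleton_subset_iff]
    exact hmem.2 ⟨1, le_opFiltration 0 (mem_spanW _ w)⟩
  rw [h.lieSpan_eq_top] at hN
  exact hmem.1 (hN (LieSubmodule.mem_top v))

/-- A nonzero submodule meets the span of `w` under the `W n`. -/
theorem exists_mem_spanW (h : IsScalarWhittaker lam mu ξ w) {N : LieSubmodule ℂ W22 V} {v : V}
    (hvN : v ∈ N) (hv0 : v ≠ 0) : ∃ u ∈ spanW Set.univ w, u ∈ N ∧ u ≠ 0 := by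
  obtain ⟨k, hk⟩ := h.exists_mem_filtrationL v
  -- The shift by 2 pairs `W (n + 2)` with `L (-n)`: their bracket is `(-n - (n + 2)) W 2`, which
  -- gives `c n = -(2n + 2) mu 2`.
  refine exists_ne_zero_mem_of_lower_stable (N := N.toSubmodule) (v := v) (k := k)
    (T := fun n => LieModule.toEnd ℂ W22 V (W (n + 2)) - mu (n + 2) • LinearMap.id)
    (c := fun n => (-(2 * (n : ℂ) + 2)) * mu 2) (fun n => ?_) (fun a b k v hv => ?_)
    (fun n k v hv => h.lie_W_sub_smul_mem k (by omega) hv) (fun n k m hm v hv => ?_)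
    (fun n k v hv => ?_) (fun n v hv => ?_) hk hvN hv0
  · refine mul_ne_zero (neg_ne_zero.2 ?_) h.mu_two
    exact_mod_cast (by omega : 2 * n + 2 ≠ 0)
  · change ⁅L _, ⁅L _, v⁆⁆ - ⁅L _, ⁅L _, v⁆⁆ ∈ filtrationL w (k + 1)
    rw [lie_L_lie_L, add_sub_cancel_right, h.lie_z]
    exact Submodule.add_mem _ (Submodule.smul_mem _ _ (lie_L_neg_mem (by omega) hv))
      (Submodule.smul_mem _ _ (Submodule.smul_mem _ _ (filtrationL_mono w k.le_succ hv)))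
  · change (⁅W _, ⁅L _, v⁆⁆ - mu _ • ⁅L _, v⁆) - ⁅L _, ⁅W _, v⁆ - mu _ • v⁆ ∈ filtrationL w k
    have h1 := h.lie_W_sub_smul_mem k (n := (n : ℤ) + 2 + -(m : ℤ)) (by omega) hv
    -- For `m < n` the index `n + 2 - m` is at least 3, so this `W` has eigenvalue 0 and itself
    -- lowers the filtration.
    rw [h.mu_eq_zero _ (by omega), zero_smul, sub_zero] at h1
    convert Submodule.smul_mem _ (((-(m : ℤ) : ℤ) : ℂ) - ((n : ℤ) + 2 : ℤ)) h1 using 1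
    rw [lie_W_lie_L, cocycle_of_ne (by omega), lie_sub, lie_smul]
    module
  · change (⁅W _, ⁅L _, v⁆⁆ - mu _ • ⁅L _, v⁆) - ⁅L _, ⁅W _, v⁆ - mu _ • v⁆ - _ ∈ filtrationL w k
    have h1 := h.lie_W_sub_smul_mem k (n := 2) (by omega) hv
    convert Submodule.smul_mem _ (-(2 * (n : ℂ) + 2)) h1 using 1
    rw [lie_W_lie_L, cocycle_of_ne (by omega), lie_sub, lie_smul,
      show (n : ℤ) + 2 + -(n : ℤ) = 2 by omega]
    push_cast
    module
  · exact N.sub_mem (N.lie_mem hv) (N.smul_mem _ hv)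

/-- The span of `w` under the `W n` with `-M < n ≤ 0`. -/
def boundedSpanW (w : V) (M : ℕ) : Submodule ℂ V := spanW {n : ℤ | -(M : ℤ) < n ∧ n ≤ 0} w

theorem lie_mem_boundedSpanW {M : ℕ} {n : ℤ} (h1 : -(M : ℤ) < n) (h2 : n ≤ 0) {v : V}
    (hv : v ∈ boundedSpanW w M) : ⁅W n, v⁆ ∈ boundedSpanW w M :=
  lie_mem_spanW (S := {n : ℤ | -(M : ℤ) < n ∧ n ≤ 0}) ⟨h1, h2⟩ hv

theorem boundedSpanW_mono (w : V) : Monotone (boundedSpanW w) := fun M M' h =>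
  spanW_le (mem_spanW _ w) fun _ hn _ hv =>
    lie_mem_boundedSpanW (lt_of_le_of_lt (by omega) hn.1) hn.2 hv

theorem exists_mem_boundedSpanW (h : IsScalarWhittaker lam mu ξ w) {v : V}
    (hv : v ∈ spanW Set.univ w) : ∃ M, v ∈ boundedSpanW w M := by
  have hdir : Directed (· ≤ ·) (boundedSpanW w) := (boundedSpanW_mono w).directed_le
  have hmem : ∀ {v}, v ∈ ⨆ k, boundedSpanW w k ↔ ∃ k, v ∈ boundedSpanW w k :=
    Submodule.mem_iSup_of_directed _ hdir
  refine hmem.1 (spanW_le (hmem.2 ⟨0, mem_spanW _ w⟩) (fun n _ v hv => ?_) hv)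
  obtain ⟨M, hM⟩ := hmem.1 hv
  rcases le_or_gt n 0 with hn | hn
  · exact hmem.2 ⟨max M (n.natAbs + 1), lie_mem_boundedSpanW (by omega) hn
      (boundedSpanW_mono w (le_max_left _ _) hM)⟩
  · rw [h.lie_W_of_mem hn hM]
    exact Submodule.smul_mem _ _ hv

/-- `W (-M)` commutes with the other `W`'s, so each vector is a polynomial in `W (-M)` with
coefficients in the smaller span. -/
theorem exists_mem_powFiltration {M : ℕ} {v : V} (hv : v ∈ boundedSpanW w (M + 1)) :
    ∃ k, v ∈ powFiltration (boundedSpanW w M) (LieModule.toEnd ℂ W22 V (W (-(M : ℤ)))) k := by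
  set F := powFiltration (boundedSpanW w M) (LieModule.toEnd ℂ W22 V (W (-(M : ℤ)))) with hF
  have hdir : Directed (· ≤ ·) F := (powFiltration_mono _ _).directed_le
  have hmem : ∀ {v}, v ∈ ⨆ k, F k ↔ ∃ k, v ∈ F k := Submodule.mem_iSup_of_directed _ hdir
  refine hmem.1 (spanW_le (hmem.2 ⟨1, Submodule.mem_sup_left (mem_spanW _ w)⟩)
    (fun n hn v hv => ?_) hv)
  obtain ⟨hn1, hn2⟩ : -((M + 1 : ℕ) : ℤ) < n ∧ n ≤ 0 := hn
  obtain ⟨k, hk⟩ := hmem.1 hv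
  rcases eq_or_ne n (-(M : ℤ)) with rfl | hne
  · exact hmem.2 ⟨k + 1, apply_mem_powFiltration hk⟩
  · refine hmem.2 ⟨k, powFiltration_stable (Y := LieModule.toEnd ℂ W22 V (W n))
      (fun v hv => lie_mem_boundedSpanW (by omega) hn2 hv) (fun v => lie_W_lie_W _ _ v) k v hk⟩

/-- For `m > -M` the bracket of `L (M + 2)` with `W m` is a multiple of `W (m + M + 2)`, whose index
is at least 3, so it acts by zero. -/
theorem lie_L_of_mem_boundedSpanW (h : IsScalarWhittaker lam mu ξ w) (M : ℕ) {v : V}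
    (hv : v ∈ boundedSpanW w M) : ⁅L ((M : ℤ) + 2), v⁆ = lam ((M : ℤ) + 2) • v := by
  have : boundedSpanW w M ≤ boundedSpanW w M ⊓ LinearMap.ker
      (LieModule.toEnd ℂ W22 V (L ((M : ℤ) + 2)) - lam ((M : ℤ) + 2) • LinearMap.id) :=
    spanW_le ⟨mem_spanW _ w, by simp [h.lie_L ((M : ℤ) + 2) (by omega)]⟩ fun m hm v hv => by
      obtain ⟨hv1, hv2⟩ := Submodule.mem_inf.1 hv
      refine Submodule.mem_inf.2 ⟨lie_mem_spanW hm hv1, ?_⟩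
      obtain ⟨hm1, -⟩ : -(M : ℤ) < m ∧ m ≤ 0 := hm
      simp only [LinearMap.mem_ker, LinearMap.sub_apply, LieModule.toEnd_apply_apply,
        LinearMap.smul_apply, LinearMap.id_apply, sub_eq_zero] at hv2 ⊢
      rw [lie_L_lie_W, cocycle_of_ne (by omega), h.lie_W_of_mem (by omega) hv1,
        h.mu_eq_zero _ (by omega), hv2, lie_smul]
      module
  simpa [sub_eq_zero] using (this hv).2

theorem mem_of_mem_spanW (h : IsScalarWhittaker lam mu ξ w) {N : LieSubmodule ℂ W22 V} {v : V}
    (hv : v ∈ spanW Set.univ w) (hvN : v ∈ N) (hv0 : v ≠ 0) : w ∈ N := by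
  obtain ⟨M, hM⟩ := h.exists_mem_boundedSpanW hv
  clear hv
  induction M generalizing v with
  | zero =>
    -- For `M = 0` no index satisfies `0 < n ≤ 0`, so only multiples of `w` are left.
    have hle : boundedSpanW w 0 ≤ Submodule.span ℂ {w} :=
      spanW_le (Submodule.mem_span_singleton_self w) fun n hn => by
        have := hn.1
        have := hn.2
        omega
    obtain ⟨c, rfl⟩ := Submodule.mem_span_singleton.1 (hle hM)
    have hc : c ≠ 0 := fun hc => hv0 (by rw [hc, zero_smul])
    have := N.smul_mem c⁻¹ hvN
    rwa [smul_smul, inv_mul_cancel₀ hc, one_smul] at this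
  | succ M ih =>
    obtain ⟨k, hk⟩ := exists_mem_powFiltration hM
    have hF : ∀ k, powFiltration (boundedSpanW w M)
        (LieModule.toEnd ℂ W22 V (W (-(M : ℤ)))) k ≤ spanW Set.univ w := by
      intro k
      induction k with
      | zero => exact bot_le
      | succ k ihk =>
        refine sup_le (spanW_mono (Set.subset_univ _) w) ?_
        rw [Submodule.map_le_iff_le_comap]
        exact fun v hv => lie_mem_spanW (Set.mem_univ _) (ihk hv)
    -- The bracket of `L (M + 2)` with `W (-M)` is `-(2M + 2) W 2`, and `W 2` acts exactly by `mu 2`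
    -- on the span of `w` under the `W`'s.
    obtain ⟨u, hu, huN, hu0⟩ := exists_ne_zero_mem_of_mem_powFiltration
      (T := LieModule.toEnd ℂ W22 V (L ((M : ℤ) + 2)) - lam ((M : ℤ) + 2) • LinearMap.id)
      (c := (-(2 * (M : ℂ) + 2)) * mu 2) (N := N.toSubmodule)
      (mul_ne_zero (neg_ne_zero.2 (by exact_mod_cast (by omega : 2 * M + 2 ≠ 0))) h.mu_two)
      (fun v hv => by simp [h.lie_L_of_mem_boundedSpanW M hv])
      (fun k v hv => by
        change (⁅L _, ⁅W _, v⁆⁆ - lam _ • ⁅W _, v⁆) - ⁅W _, ⁅L _, v⁆ - lam _ • v⁆ = _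
        rw [lie_L_lie_W, cocycle_of_ne (by omega), lie_sub, lie_smul,
          show -(M : ℤ) + ((M : ℤ) + 2) = 2 by omega, h.lie_W_of_mem two_pos (hF k hv)]
        push_cast
        module)
      (fun v hv => N.sub_mem (N.lie_mem hv) (N.smul_mem _ hv)) hk hvN hv0
    exact ih huN hu0 hu

/-- A cyclic Whittaker module on which `z` acts by a scalar has no proper nonzero submodule. -/
theorem eq_bot_or_eq_top (h : IsScalarWhittaker lam mu ξ w) (N : LieSubmodule ℂ W22 V) :
    N = ⊥ ∨ N = ⊤ := by
  refine or_iff_not_imp_left.2 fun hN => ?_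
  obtain ⟨v, hv, hv0⟩ := 
    Submodule.exists_mem_ne_zero_of_ne_bot (mt N.toSubmodule_eq_bot.1 hN)
  obtain ⟨u, hu, huN, hu0⟩ := h.exists_mem_spanW hv hv0
  rw [eq_top_iff, ← h.lieSpan_eq_top, LieSubmodule.lieSpan_le, Set.singleton_subset_iff]
  exact h.mem_of_mem_spanW hu huN hu0

end IsScalarWhittaker

end Simple

end W22

/-! ### Polynomials in `z` as module endomorphisms -/

namespace W22

section Decomposition

variable {V : Type*} [AddCommGroup V] [Module ℂ V] [LieRingModule W22 V] [LieModule ℂ W22 V]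

theorem polyAct_mul (p q : ℂ[X]) (v : V) : polyAct (p * q) v = polyAct p (polyAct q v) := by
  simp only [polyAct, map_mul, Module.End.mul_apply]

theorem polyAct_X_sub_C (ξ : ℂ) (v : V) : polyAct (X - C ξ) v = ⁅z, v⁆ - ξ • v := by
  simp [polyAct]

theorem lie_lie_z (x : W22) (v : V) : ⁅x, ⁅z, v⁆⁆ = ⁅z, ⁅x, v⁆⁆ := by
  rw [leibniz_lie z x v, lie_z_left, zero_lie, zero_add]

theorem polyAct_lie (p : ℂ[X]) (x : W22) (v : V) : polyAct p ⁅x, v⁆ = ⁅x, polyAct p v⁆ := by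
  induction p using Polynomial.induction_on generalizing v with
  | C c => simp [polyAct]
  | add p q hp hq =>
    simp only [polyAct, map_add, LinearMap.add_apply, lie_add] at hp hq ⊢
    rw [hp, hq]
  | monomial n c h =>
    rw [pow_succ, ← mul_assoc, polyAct_mul, polyAct_mul _ X v]
    have hX : ∀ u : V, polyAct X u = ⁅z, u⁆ := fun u => by simp [polyAct]
    rw [hX, hX, ← lie_lie_z, h]

/-- The action of a polynomial in `z`, as an endomorphism of the module. -/
noncomputable def polyHom (V : Type*) [AddCommGroup V] [Module ℂ V] [LieRingModule W22 V]
    [LieModule ℂ W22 V] (p : ℂ[X]) : V →ₗ⁅ℂ,W22⁆ V where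
  toLinearMap := Polynomial.aeval (LieModule.toEnd ℂ W22 V z) p
  map_lie' := fun {x v} => polyAct_lie p x v

theorem polyHom_apply (p : ℂ[X]) (v : V) : polyHom V p v = polyAct p v := rfl

theorem mem_annZ {p : ℂ[X]} {v : V} : p ∈ annZ v ↔ polyAct p v = 0 := Iff.rfl

section Hom

variable {V' : Type*} [AddCommGroup V'] [Module ℂ V'] [LieRingModule W22 V'] [LieModule ℂ W22 V']

theorem map_polyAct (f : V →ₗ⁅ℂ,W22⁆ V') (p : ℂ[X]) (v : V) :
    f (polyAct p v) = polyAct p (f v) := by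
  induction p using Polynomial.induction_on generalizing v with
  | C c => simp [polyAct]
  | add p q hp hq =>
    simp only [polyAct, map_add, LinearMap.add_apply] at hp hq ⊢
    rw [hp, hq]
  | monomial n c h =>
    rw [pow_succ, ← mul_assoc, polyAct_mul, polyAct_mul _ X (f v), h]
    simp [polyAct]

theorem IsWhittakerVector.map {φ : LieAlgebra.LieCharacter ℂ positivePart} {v : V}
    (hv : IsWhittakerVector φ v) (f : V →ₗ⁅ℂ,W22⁆ V') : IsWhittakerVector φ (f v) := fun x => by
  rw [← LieModuleHom.map_lie, hv x, map_smul]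

/-- Used with `f` a polynomial in `z`, this turns cyclic submodules into images `q(z) V`. -/
theorem range_eq_cyclicSubmodule {w : V} (hw : LieSubmodule.lieSpan ℂ W22 {w} = ⊤)
    (f : V →ₗ⁅ℂ,W22⁆ V') : f.range = cyclicSubmodule (f w) := by
  refine le_antisymm ?_ ?_
  · have h : LieSubmodule.lieSpan ℂ W22 {w} ≤ (cyclicSubmodule (f w)).comap f := by
      rw [LieSubmodule.lieSpan_le, Set.singleton_subset_iff]
      exact LieSubmodule.subset_lieSpan (Set.mem_singleton (f w))
    rw [hw] at h
    intro y hy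
    obtain ⟨v, rfl⟩ := (LieModuleHom.mem_range f y).1 hy
    exact h (LieSubmodule.mem_top v)
  · rw [cyclicSubmodule, LieSubmodule.lieSpan_le, Set.singleton_subset_iff]
    exact (LieModuleHom.mem_range f _).2 ⟨w, rfl⟩

theorem IsCyclicWhittakerVector.map {φ : LieAlgebra.LieCharacter ℂ positivePart} {w : V}
    (hw : IsCyclicWhittakerVector φ w) (f : V →ₗ⁅ℂ,W22⁆ V') (hf : Function.Surjective f) :
    IsCyclicWhittakerVector φ (f w) :=
  ⟨hw.1, hw.2.1.map f, ((range_eq_cyclicSubmodule hw.2.2 f).symm.trans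
    ((LieModuleHom.range_eq_top f).2 hf))⟩

end Hom

theorem lieSpan_cyclicGenerator (v : V) :
    LieSubmodule.lieSpan ℂ W22 {cyclicGenerator v} = ⊤ := by
  set N := LieSubmodule.lieSpan ℂ W22 {cyclicGenerator v}
  have h : LieSubmodule.lieSpan ℂ W22 {v} ≤ N.map (cyclicSubmodule v).incl := by
    rw [LieSubmodule.lieSpan_le, Set.singleton_subset_iff]
    exact (LieSubmodule.mem_map _).2
      ⟨cyclicGenerator v, LieSubmodule.subset_lieSpan (Set.mem_singleton _), rfl⟩
  refine eq_top_iff.2 fun x _ => ?_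
  obtain ⟨y, hy, hyx⟩ := (LieSubmodule.mem_map _).1 (h x.2)
  rwa [← Subtype.ext (a1 := y) (a2 := x) hyx]

theorem IsWhittakerVector.isCyclicWhittakerVector_cyclicGenerator
    {φ : LieAlgebra.LieCharacter ℂ positivePart} {v : V} (hv : IsWhittakerVector φ v)
    (hφ : IsNonsingular φ) : IsCyclicWhittakerVector φ (cyclicGenerator v) :=
  ⟨hφ, fun x => Subtype.ext (hv x), lieSpan_cyclicGenerator v⟩

/-- A character kills brackets, and the bracket of `L 1` with `W (n - 1)` is `(n - 2) W n`. -/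
theorem apply_posW_eq_zero (φ : LieAlgebra.LieCharacter ℂ positivePart) {n : ℤ} (hn : 3 ≤ n) :
    φ (posW n (by omega)) = 0 := by
  have h1 : ⁅posL 1 one_pos, posW (n - 1) (by omega)⁆ = ((n : ℂ) - 2) • posW n (by omega) := by
    refine Subtype.ext ?_
    change ⁅L 1, W (n - 1)⁆ = ((n : ℂ) - 2) • W n
    rw [lie_L_W, cocycle_of_ne (by omega), zero_smul, add_zero, sub_add_cancel]
    congr 1
    push_cast
    ring
  have h2 := LieAlgebra.lieCharacter_apply_lie φ (posL 1 one_pos) (posW (n - 1) (by omega))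
  rw [h1, map_smul, smul_eq_mul] at h2
  refine (mul_eq_zero.1 h2).resolve_left ?_
  rw [sub_eq_zero]
  exact_mod_cast (by omega : n ≠ 2)

theorem IsCyclicWhittakerVector.isScalarWhittaker {φ : LieAlgebra.LieCharacter ℂ positivePart}
    {w : V} (hw : IsCyclicWhittakerVector φ w) {ξ : ℂ} (hz : ∀ v : V, ⁅z, v⁆ = ξ • v) :
    IsScalarWhittaker (fun n => if h : 0 < n then φ (posL n h) else 0)
      (fun n => if h : 0 < n then φ (posW n h) else 0) ξ w where
  lie_L n hn := by
    rw [dif_pos hn]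
    exact hw.2.1 (posL n hn)
  lie_W n hn := by
    rw [dif_pos hn]
    exact hw.2.1 (posW n hn)
  mu_two := by
    rw [dif_pos two_pos]
    exact right_ne_zero_of_mul hw.1.2
  mu_eq_zero n hn := by
    rw [dif_pos (by omega)]
    exact apply_posW_eq_zero φ hn
  lie_z := hz
  lieSpan_eq_top := hw.2.2

/-! ### Cyclic Whittaker modules killed by a power of `z - ξ` -/

section Primary

variable {φ : LieAlgebra.LieCharacter ℂ positivePart} {w : V}

/-- `(z - ξ) V` has no proper submodule strictly above it. -/
theorem IsCyclicWhittakerVector.eq_range_or_eq_top (hw : IsCyclicWhittakerVector φ w) (ξ : ℂ)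
    {N : LieSubmodule ℂ W22 V} (hN : (polyHom V (X - C ξ)).range ≤ N) :
    N = (polyHom V (X - C ξ)).range ∨ N = ⊤ := by
  set R := (polyHom V (X - C ξ)).range with hR
  have hsurj := LieSubmodule.Quotient.surjective_mk' R
  -- On the quotient by `(z - ξ)V` the central element acts by `ξ`, so the scalar case applies
  -- there.
  have hz : ∀ v : V ⧸ R, ⁅z, v⁆ = ξ • v := fun v => by
    obtain ⟨v, rfl⟩ := hsurj v
    rw [← LieModuleHom.map_lie, ← map_smul, ← sub_eq_zero, ← map_sub,
      LieSubmodule.Quotient.mk_eq_zero, ← polyAct_X_sub_C]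
    exact (LieModuleHom.mem_range _ _).2 ⟨v, rfl⟩
  rcases ((hw.map _ hsurj).isScalarWhittaker hz).eq_bot_or_eq_top
    (N.map (LieSubmodule.Quotient.mk' R)) with h | h
  · exact Or.inl (le_antisymm ((LieSubmodule.Quotient.map_mk'_eq_bot_le _ _).1 h) hN)
  · refine Or.inr (eq_top_iff.2 fun v _ => ?_)
    have hv : LieSubmodule.Quotient.mk' R v ∈ N.map (LieSubmodule.Quotient.mk' R) := by
      rw [h]
      exact LieSubmodule.mem_top _
    obtain ⟨n, hn, hnv⟩ := (LieSubmodule.mem_map _).1 hv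
    rw [← sub_eq_zero, ← map_sub, LieSubmodule.Quotient.mk_eq_zero] at hnv
    have := N.sub_mem hn (hN hnv)
    rwa [sub_sub_cancel] at this

theorem mem_range_polyHom {p : ℂ[X]} {v : V} :
    v ∈ (polyHom V p).range ↔ ∃ u, polyAct p u = v := LieModuleHom.mem_range _ _

variable {ξ : ℂ} {a : ℕ}

theorem IsCyclicWhittakerVector.covBy_range (hw : IsCyclicWhittakerVector φ w)
    (ha : ∀ v : V, polyAct ((X - C ξ) ^ a) v = 0) (hne : polyAct ((X - C ξ) ^ (a - 1)) w ≠ 0)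
    {s : ℕ} (hs : s < a) :
    (polyHom V ((X - C ξ) ^ (s + 1))).range ⋖ (polyHom V ((X - C ξ) ^ s)).range := by
  refine ⟨lt_of_le_not_ge (fun v hv => ?_) fun hle => ?_, fun N h1 h2 => ?_⟩
  · obtain ⟨u, rfl⟩ := mem_range_polyHom.1 hv
    rw [pow_succ, polyAct_mul]
    exact mem_range_polyHom.2 ⟨_, rfl⟩
  -- If the two images agreed, `(z - ξ)^s w` would equal `(z - ξ)^(s + 1) u`; multiplying by `(z -
  -- ξ)^(a - 1 - s)` would give `(z - ξ)^(a - 1) w = 0`.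
  · obtain ⟨u, hu⟩ := mem_range_polyHom.1 (hle (mem_range_polyHom.2 ⟨w, rfl⟩))
    refine hne ?_
    rw [show a - 1 = (a - 1 - s) + s by omega, pow_add, polyAct_mul, ← hu, ← polyAct_mul,
      ← pow_add, show a - 1 - s + (s + 1) = a by omega, ha]
  -- Pulling an intermediate submodule back along `(z - ξ)^s` gives a submodule containing `(z -
  -- ξ)V`, which leaves only two choices.
  · rcases hw.eq_range_or_eq_top ξ (N := N.comap (polyHom V ((X - C ξ) ^ s))) (fun v hv => by
      obtain ⟨u, rfl⟩ := mem_range_polyHom.1 hv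
      refine h1.le (mem_range_polyHom.2 ⟨u, ?_⟩)
      rw [pow_succ, polyAct_mul]
      rfl) with h | h
    · refine h1.not_ge fun n hn => ?_
      obtain ⟨v, rfl⟩ := mem_range_polyHom.1 (h2.le hn)
      have hv : v ∈ N.comap (polyHom V ((X - C ξ) ^ s)) := hn
      rw [h] at hv
      obtain ⟨u, rfl⟩ := mem_range_polyHom.1 hv
      exact mem_range_polyHom.2 ⟨u, by rw [pow_succ, polyAct_mul]⟩
    · refine h2.not_ge fun n hn => ?_
      obtain ⟨v, rfl⟩ := mem_range_polyHom.1 hn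
      have hv : v ∈ N.comap (polyHom V ((X - C ξ) ^ s)) := by
        rw [h]
        exact LieSubmodule.mem_top _
      exact hv

theorem IsCyclicWhittakerVector.hasCompositionLength (hw : IsCyclicWhittakerVector φ w)
    (ha : ∀ v : V, polyAct ((X - C ξ) ^ a) v = 0) (hne : polyAct ((X - C ξ) ^ (a - 1)) w ≠ 0) :
    HasCompositionLength V a := by
  refine ⟨fun i => (polyHom V ((X - C ξ) ^ (a - (i : ℕ)))).range, ?_, ?_, fun i => ?_⟩
  · refine eq_bot_iff.2 fun v hv => ?_
    obtain ⟨u, rfl⟩ := mem_range_polyHom.1 hv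
    rw [Fin.val_zero, Nat.sub_zero, ha]
    exact LieSubmodule.zero_mem _
  · refine eq_top_iff.2 fun v _ => mem_range_polyHom.2 ⟨v, ?_⟩
    simp [polyAct]
  · have h := hw.covBy_range ha hne (s := a - (i + 1)) (by omega)
    rw [show a - (i + 1) + 1 = a - i by omega] at h
    exact h

/-- A submodule that spans `V` modulo `(z - ξ) V` is everything if `z - ξ` is nilpotent. -/
theorem eq_top_of_sup_range_eq_top (ha : ∀ v : V, polyAct ((X - C ξ) ^ a) v = 0)
    {N : LieSubmodule ℂ W22 V} (hN : N ⊔ (polyHom V (X - C ξ)).range = ⊤) : N = ⊤ := by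
  -- Nakayama: substituting `V = N + (z - ξ)V` into itself gives `V = N + (z - ξ)^s V` for every
  -- `s`, and `s = a` kills the second summand.
  have key : ∀ (s : ℕ) (v : V), ∃ n ∈ N, ∃ u, n + polyAct ((X - C ξ) ^ s) u = v := by
    intro s v
    induction s with
    | zero => exact ⟨0, N.zero_mem, v, by simp [polyAct]⟩
    | succ s ih =>
      obtain ⟨n, hn, u, rfl⟩ := ih
      obtain ⟨n', hn', x, hx, rfl⟩ := (LieSubmodule.mem_sup _ _ _).1
        (show u ∈ N ⊔ (polyHom V (X - C ξ)).range by rw [hN]; exact LieSubmodule.mem_top u)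
      obtain ⟨u', rfl⟩ := mem_range_polyHom.1 hx
      refine ⟨n + polyAct ((X - C ξ) ^ s) n', N.add_mem hn ?_, u', ?_⟩
      · have h : polyAct ((X - C ξ) ^ s) (N.incl ⟨n', hn'⟩) ∈ N := by
          rw [← map_polyAct]
          exact Subtype.property _
        exact h
      · rw [pow_succ, polyAct_mul, ← polyHom_apply _ (n' + _), map_add, add_assoc]
        rfl
  refine eq_top_iff.2 fun v _ => ?_
  obtain ⟨n, hn, u, rfl⟩ := key a v
  rwa [ha, add_zero]

theorem IsCyclicWhittakerVector.isIndecomposable (hw : IsCyclicWhittakerVector φ w) (hw0 : w ≠ 0)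
    (ha : ∀ v : V, polyAct ((X - C ξ) ^ a) v = 0) : IsIndecomposable V := by
  refine ⟨⟨w, 0, hw0⟩, fun N₁ N₂ h => ?_⟩
  -- Either `N₁` lies in `(z - ξ)V`, and then `N₂` spans modulo it, or `N₁` does. By Nakayama the
  -- spanning summand is everything, so its complement is zero.
  rcases hw.eq_range_or_eq_top ξ (N := N₁ ⊔ (polyHom V (X - C ξ)).range) le_sup_right with h1 | h1
  · left
    have h2 : N₂ ⊔ (polyHom V (X - C ξ)).range = ⊤ := by
      rw [← h1, sup_left_comm, ← sup_assoc, h.sup_eq_top, top_sup_eq]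
    have := h.inf_eq_bot
    rwa [eq_top_of_sup_range_eq_top ha h2, inf_top_eq] at this
  · right
    have := h.inf_eq_bot
    rwa [eq_top_of_sup_range_eq_top ha h1, top_inf_eq] at this

end Primary

end Decomposition

end W22

/-! ### The primary decomposition -/

theorem theorem5p1p2 {V : Type*} [AddCommGroup V] [Module ℂ V] [LieRingModule W22 V]
    [LieModule ℂ W22 V] (φ : LieAlgebra.LieCharacter ℂ W22.positivePart) (w : V)
    (hw : W22.IsCyclicWhittakerVector φ w) (hne : W22.annZ w ≠ ⊥)
    (p : ℂ[X]) (hp : p.Monic) (hgen : W22.annZ w = Ideal.span {p})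
    (k : ℕ) (ξ : Fin k → ℂ) (hξ : Function.Injective ξ) (a : Fin k → ℕ) (ha : ∀ i, 0 < a i)
    (hfac : p = ∏ i, (X - C (ξ i)) ^ a i)
    (w' : Fin k → V)
    (hw' : ∀ j, w' j =
      W22.polyAct (∏ i ∈ Finset.univ.filter (fun i => i ≠ j), (X - C (ξ i)) ^ a i) w) :
    (∀ j, W22.IsCyclicWhittakerVector φ (W22.cyclicGenerator (w' j))) ∧
    DirectSum.IsInternal (fun j => (W22.cyclicSubmodule (w' j)).toSubmodule) ∧
    (∀ j, W22.IsIndecomposable (W22.cyclicSubmodule (w' j))) ∧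
    (∀ j, W22.HasCompositionLength (W22.cyclicSubmodule (w' j)) (a j)) := by
  set f : Fin k → ℂ[X] :=
    fun j => ∏ i ∈ Finset.univ.filter (fun i => i ≠ j), (X - C (ξ i)) ^ a i with hf
  have hfp : ∀ j, (X - C (ξ j)) ^ a j * f j = p := fun j => by
    rw [hfac, hf]
    simp only [Finset.filter_ne']
    exact Finset.mul_prod_erase _ (fun i => (X - C (ξ i)) ^ a i) (Finset.mem_univ j)
  have hcyc : ∀ j, (W22.polyHom V (f j)).range = W22.cyclicSubmodule (w' j) := fun j => by
    rw [hw' j]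
    exact W22.range_eq_cyclicSubmodule hw.2.2 _
  have hpw : W22.polyAct p w = 0 := by
    rw [← W22.mem_annZ, hgen]
    exact Ideal.mem_span_singleton_self p
  -- The image `p(z) V` is generated by `p(z) w = 0`.
  have hpV : ∀ v : V, W22.polyAct p v = 0 := fun v => by
    have h : W22.polyAct p v ∈ (W22.polyHom V p).range := W22.mem_range_polyHom.2 ⟨v, rfl⟩
    rw [W22.range_eq_cyclicSubmodule hw.2.2, W22.polyHom_apply, hpw, W22.cyclicSubmodule,
      (LieSubmodule.lieSpan_eq_bot_iff ℂ W22 V).2 (by simp)] at h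
    exact h
  have hkill : ∀ j, ∀ v ∈ W22.cyclicSubmodule (w' j),
      W22.polyAct ((X - C (ξ j)) ^ a j) v = 0 := fun j v hv => by
    rw [← hcyc j] at hv
    obtain ⟨u, rfl⟩ := W22.mem_range_polyHom.1 hv
    rw [← W22.polyAct_mul, hfp, hpV]
  have hcoe : ∀ j (q : ℂ[X]) (v : W22.cyclicSubmodule (w' j)),
      ((W22.polyAct q v : W22.cyclicSubmodule (w' j)) : V) = W22.polyAct q (v : V) :=
    fun j q v => W22.map_polyAct (W22.cyclicSubmodule (w' j)).incl q v
  have hkill' : ∀ j (v : W22.cyclicSubmodule (w' j)),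
      W22.polyAct ((X - C (ξ j)) ^ a j) v = 0 := fun j v =>
    Subtype.ext ((hcoe j _ v).trans (hkill j v v.2))
  -- Otherwise `p` would divide a nonzero polynomial whose degree is one less than its own.
  have hne' : ∀ j, W22.polyAct ((X - C (ξ j)) ^ (a j - 1)) (W22.cyclicGenerator (w' j)) ≠ 0 := by
    intro j h
    have h1 : W22.polyAct ((X - C (ξ j)) ^ (a j - 1)) (w' j) = 0 :=
      (hcoe j _ _).symm.trans (congrArg Subtype.val h)
    rw [hw' j, ← W22.polyAct_mul, ← W22.mem_annZ, hgen, Ideal.mem_span_singleton] at h1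
    have h2 : p = (X - C (ξ j)) * ((X - C (ξ j)) ^ (a j - 1) * f j) := by
      rw [← mul_assoc, ← pow_succ', Nat.sub_add_cancel (ha j), hfp]
    have h3 : (X - C (ξ j)) ^ (a j - 1) * f j ≠ 0 := fun h0 =>
      hp.ne_zero (by rw [h2, h0, mul_zero])
    have h4 := Polynomial.natDegree_le_of_dvd h1 h3
    rw [h2, Polynomial.natDegree_mul (Polynomial.X_sub_C_ne_zero _) h3,
      Polynomial.natDegree_X_sub_C] at h4
    change _ ≤ ((X - C (ξ j)) ^ (a j - 1) * f j).natDegree at h4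
    omega
  have hwh : ∀ j, W22.IsCyclicWhittakerVector φ (W22.cyclicGenerator (w' j)) := fun j => by
    refine W22.IsWhittakerVector.isCyclicWhittakerVector_cyclicGenerator ?_ hw.1
    rw [hw' j]
    exact hw.2.1.map (W22.polyHom V _)
  refine ⟨hwh, ?_, fun j => (hwh j).isIndecomposable (fun h0 => hne' j ?_) (hkill' j),
    fun j => (hwh j).hasCompositionLength (hkill' j) (hne' j)⟩
  · refine DirectSum.isInternal_submodule_of_iSupIndep_of_iSup_eq_top ?_ ?_
    -- Each summand lies in the generalized eigenspace of `z` for `ξ j`, and the `ξ j` are distinct.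
    · refine ((Module.End.independent_maxGenEigenspace
        (LieModule.toEnd ℂ W22 V W22.z)).comp hξ).mono fun j v hv => ?_
      refine (Module.End.mem_maxGenEigenspace _ _ _).2 ⟨a j, ?_⟩
      have h := hkill j v hv
      simpa [W22.polyAct, Algebra.algebraMap_eq_smul_one] using h
    · rw [LieSubmodule.iSup_toSubmodule_eq_top, eq_top_iff, ← hw.2.2, LieSubmodule.lieSpan_le,
        Set.singleton_subset_iff]
      -- The Bézout identity needs at least one factor. If there is none, then `p = 1`, so `w = 0`.
      rcases isEmpty_or_nonempty (Fin k) with he | he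
      · rw [hfac, Finset.univ_eq_empty, Finset.prod_empty] at hpw
        have : w = 0 := by simpa [W22.polyAct] using hpw
        rw [this]
        exact LieSubmodule.zero_mem _
      -- Pairwise coprimality of the primary factors gives `∑ μ i * f i = 1`; applied to `w`, this
      -- writes `w` as a sum of elements of the `V_i`.
      · obtain ⟨μ, hμ⟩ := exists_sum_eq_one_iff_pairwise_coprime'.2
          (fun i j hij => ((Polynomial.pairwise_coprime_X_sub_C hξ) hij).pow :
            Pairwise (Function.onFun IsCoprime fun i => (X - C (ξ i)) ^ a i))
        have h1 : w = ∑ i, W22.polyAct (μ i * f i) w := by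
          have : W22.polyAct (∑ i, μ i * f i) w = w := by
            have hμ' : ∑ i, μ i * f i = 1 := by
              rw [← hμ]
              refine Finset.sum_congr rfl fun i _ => ?_
              rw [hf]
              exact congrArg _ (Finset.prod_congr (by ext; simp) fun _ _ => rfl)
            rw [hμ']
            simp [W22.polyAct]
          conv_lhs => rw [← this]
          simp only [W22.polyAct, map_sum, LinearMap.sum_apply]
        rw [h1]
        refine sum_mem fun i _ => ?_
        refine (le_iSup (fun j => W22.cyclicSubmodule (w' j)) i) ?_
        rw [← hcyc i, mul_comm, W22.polyAct_mul]
        exact W22.mem_range_polyHom.2 ⟨_, rfl⟩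
  · rw [h0]
    simp [W22.polyAct]
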